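/- All graphs are finite and have at least one vertex; parallel edges are allowed, loops are not. A \emph{unique shortest path} in a graph is a shortest path between two vertices $u,v$ such that no other path from $u$ to $v$ has the same length (paths using different parallel edges count as different; a single vertex is such a path). A \emph{parade} of $G$ is a unique shortest path with the largest possible number of vertices. The \emph{spectator number} of $G$ is the number of vertices of $G$ outside a parade. A \emph{minor} of $H$ is a graph obtained (up to isomorphism) from $H$ by a finite sequence of deletions of isolated vertices, deletions of edges, and contractions of edges that have no edge in parallel with them. The \emph{spectator floor} of $G$ is the minimum of the spectator numbers of all graphs $H$ of which $G$ is a minor. For $p\ge 2$, a \emph{crowded $p$-parade} is a graph $G$ with a parade $P$ on $p$ vertices such that (i) every vertex outside $P$ is adjacent to exactly two vertices of $P$, and these two vertices are adjacent to each other; (ii) any two distinct vertices outside $P$ that are adjacent to a common vertex of $P$ are adjacent to each other. It is \emph{$m$-saturated} if, for such a $P$, every edge not in $P$ has exactly $m$ parallel copies, counting itself. An \emph{$m$-saturated crowded $1$-parade} is a graph in which any two distinct vertices are joined by exactly $m$ edges. \textbf{Theorem.} Let $n\ge 1$, $k\ge 0$ and $m$ be integers such that either $k\le n-2$ and $m\ge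 1$, or $k=n-1$ and $m\ge 2$. Let $G$ be a graph with $n$ vertices that is an $m$-saturated crowded $(n-k)$-parade. Then $G$ is minor-maximal among the graphs with $n$ vertices, at most $m$ parallel edges between any two vertices, and spectator floor $k$; that is, $G$ belongs to this class, and every graph of this class that has $G$ as a minor is isomorphic to $G$. -/

import Mathlib

universe u v u' v'

namespace SpectatorFloor

open scoped Graph

/-- The standing convention on graphs: finite, with at least one vertex, without loops
(parallel edges are allowed). -/
structure IsMultigraph {α : Type u} {β : Type v} (G : Graph α β) : Prop where
  nonempty : V(G).Nonempty
  finite_vertexSet : V(G).Finite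
  finite_edgeSet : E(G).Finite
  loopless : G.Loopless

/-- The number of (parallel) edges joining `x` and `y`. -/
noncomputable def multiplicity {α : Type u} {β : Type v} (G : Graph α β) (x y : α) : ℕ :=
  {e : β | G.IsLink e x y}.ncard

/-! ### Walks, paths, parades -/

/-- A walk records both its vertices and its edges, so walks that use different parallel
edges are different. -/
inductive Walk {α : Type u} {β : Type v} (G : Graph α β) : α → α → Type (max u v)
  | nil (x : α) (hx : x ∈ V(G)) : Walk G x x
  | cons {x y z : α} (e : β) (h : G.IsLink e x y) (w : Walk G y z) : Walk G x z

namespace Walk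

/-- The sequence of vertices of a walk. -/
def support {α : Type u} {β : Type v} {G : Graph α β} : {x y : α} → Walk G x y → List α
  | _, _, nil x _ => [x]
  | x, _, cons _ _ w => x :: w.support

/-- The sequence of edges of a walk. -/
def edges {α : Type u} {β : Type v} {G : Graph α β} : {x y : α} → Walk G x y → List β
  | _, _, nil _ _ => []
  | _, _, cons e _ w => e :: w.edges

/-- The length of a walk: the number of its edges. -/
def length {α : Type u} {β : Type v} {G : Graph α β} {x y : α} (w : Walk G x y) : ℕ :=
  w.edges.length

/-- The order of a path: one more than its length. -/
def order {α : Type u} {β : Type v} {G : Graph α β} {x y : α} (w : Walk G x y) : ℕ :=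
  w.length + 1

/-- A path is a walk all of whose vertices are distinct. -/
def IsPath {α : Type u} {β : Type v} {G : Graph α β} {x y : α} (w : Walk G x y) : Prop :=
  w.support.Nodup

/-- A shortest path between its endpoints. -/
def IsShortestPath {α : Type u} {β : Type v} {G : Graph α β} {x y : α} (w : Walk G x y) :
    Prop :=
  w.IsPath ∧ ∀ w' : Walk G x y, w'.IsPath → w.order ≤ w'.order

/-- A shortest path identical to every path of the same order with the same endpoints. -/
def IsUniqueShortestPath {α : Type u} {β : Type v} {G : Graph α β} {x y : α}
    (w : Walk G x y) : Prop :=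
  w.IsShortestPath ∧ ∀ w' : Walk G x y, w'.IsPath → w'.order = w.order → w' = w

/-- A parade: a unique shortest path whose order is the largest possible one for unique
shortest paths of the graph. -/
def IsParade {α : Type u} {β : Type v} {G : Graph α β} {x y : α} (w : Walk G x y) : Prop :=
  w.IsUniqueShortestPath ∧
    ∀ (x' y' : α) (w' : Walk G x' y'), w'.IsUniqueShortestPath → w'.order ≤ w.order

end Walk

/-- The parade number: the largest order of a unique shortest path. -/
noncomputable def paradeNumber {α : Type u} {β : Type v} (G : Graph α β) : ℕ :=
  sSup {p : ℕ | ∃ (x y : α) (w : Walk G x y), w.IsUniqueShortestPath ∧ w.order = p}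

/-- The spectator number: the number of vertices outside a parade. -/
noncomputable def spectatorNumber {α : Type u} {β : Type v} (G : Graph α β) : ℕ :=
  V(G).ncard - paradeNumber G

/-! ### Minors -/

/-- Isomorphism of multigraphs. -/
structure Iso {α : Type u} {β : Type v} {α' : Type u'} {β' : Type v'}
    (G : Graph α β) (H : Graph α' β') where
  vertexEquiv : V(G) ≃ V(H)
  edgeEquiv : E(G) ≃ E(H)
  isLink_iff : ∀ (e : E(G)) (x y : V(G)),
    G.IsLink e x y ↔ H.IsLink (edgeEquiv e) (vertexEquiv x) (vertexEquiv y)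

open Classical in
/-- Contraction of an edge `e` with ends `x` and `y`: delete `e` and identify `y` with `x`. -/
noncomputable def contractEdge {α : Type u} {β : Type v} (H : Graph α β) (e : β) (x y : α) :
    Graph α β :=
  (H.deleteEdges {e}).map fun z => if z = y then x else z

/-- `IsElementaryMinor G H`: the graph `G` arises from `H` by deleting one isolated vertex,
by deleting one edge, or by contracting one edge that has no edge in parallel with it. -/
inductive IsElementaryMinor {α : Type u} {β : Type v} : Graph α β → Graph α β → Prop
  | deleteVertex (H : Graph α β) (x : α) (hx : x ∈ V(H)) (hiso : ∀ e, ¬ H.Inc e x) :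
      IsElementaryMinor (H.deleteVerts {x}) H
  | deleteEdge (H : Graph α β) (e : β) (he : e ∈ E(H)) :
      IsElementaryMinor (H.deleteEdges {e}) H
  | contract (H : Graph α β) (e : β) (x y : α) (he : H.IsLink e x y)
      (hpar : ∀ f, H.IsLink f x y → f = e) :
      IsElementaryMinor (contractEdge H e x y) H

/-- `IsMinor G H`: up to isomorphism, `G` arises from `H` by a finite (possibly empty)
sequence of elementary minor operations. -/
def IsMinor {α : Type u} {β : Type v} {α' : Type u'} {β' : Type v'}
    (G : Graph α β) (H : Graph α' β') : Prop :=
  ∃ K : Graph α' β',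
    Relation.ReflTransGen (fun A B => IsElementaryMinor B A) H K ∧ Nonempty (Iso G K)

/-- The spectator floor: the minimum of the spectator number over all graphs of which `G`
is a minor. -/
noncomputable def spectatorFloor {α : Type u} {β : Type v} (G : Graph α β) : ℕ :=
  sInf {s : ℕ | ∃ (α' : Type u) (β' : Type v) (H : Graph α' β'),
    IsMultigraph H ∧ IsMinor G H ∧ spectatorNumber H = s}

/-- The class of graphs with `n` vertices, at most `m` parallel edges between any two
vertices, and spectator floor `k`. -/
structure InFloorClass (n m k : ℕ) {α : Type u} {β : Type v} (G : Graph α β) : Prop where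
  isMultigraph : IsMultigraph G
  card_vertexSet : V(G).ncard = n
  multiplicity_le : ∀ x ∈ V(G), ∀ y ∈ V(G), multiplicity G x y ≤ m
  spectatorFloor_eq : spectatorFloor G = k

/-- `G` is minor-maximal in a class of graphs: it belongs to the class, and the only graph
of the class having `G` as a minor is, up to isomorphism, `G` itself. -/
def IsMinorMaximal (C : (α : Type u) → (β : Type v) → Graph α β → Prop)
    {α : Type u} {β : Type v} (G : Graph α β) : Prop :=
  C α β G ∧ ∀ (α' : Type u) (β' : Type v) (H : Graph α' β'),
    C α' β' H → IsMinor G H → Nonempty (Iso G H)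

/-! ### Crowded parades -/

/-- `G` is crowded along the parade `P`. -/
structure IsCrowdedAlong {α : Type u} {β : Type v} (G : Graph α β) {a b : α}
    (P : Walk G a b) : Prop where
  isParade : P.IsParade
  /-- Every vertex outside `P` is adjacent to exactly two vertices of `P`, and those two are
  adjacent to each other. -/
  adj_two : ∀ x ∈ V(G), x ∉ P.support → ∃ y ∈ P.support, ∃ z ∈ P.support,
    y ≠ z ∧ G.Adj y z ∧ ∀ t ∈ P.support, G.Adj x t ↔ t = y ∨ t = z
  /-- Two vertices outside `P` that are adjacent to a common vertex of `P` are adjacent. -/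
  adj_of_common : ∀ x ∈ V(G), ∀ x' ∈ V(G), x ∉ P.support → x' ∉ P.support → x ≠ x' →
    (∃ t ∈ P.support, G.Adj x t ∧ G.Adj x' t) → G.Adj x x'

/-- `G` is an `m`-saturated crowded `p`-parade. For `p ≥ 2`: it is crowded along a parade `P`
of order `p`, and every edge not in `P` belongs to a class of exactly `m` parallel edges.
For `p = 1`: any two distinct vertices are joined by exactly `m` edges. -/
def IsSaturatedCrowdedParade (m p : ℕ) {α : Type u} {β : Type v} (G : Graph α β) : Prop :=
  (2 ≤ p ∧ ∃ (a b : α) (P : Walk G a b), IsCrowdedAlong G P ∧ P.order = p ∧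
    ∀ (e : β) (x y : α), G.IsLink e x y → e ∉ P.edges → multiplicity G x y = m) ∨
  (p = 1 ∧ ∀ x ∈ V(G), ∀ y ∈ V(G), x ≠ y → multiplicity G x y = m)

end SpectatorFloor

/-!
Give each vertex an integer position so that every even position holds at most one vertex,
adjacent vertices are at distance at most `2`, and two vertices at even positions are joined by at
most one edge (`IsLayout`). Such layouts, with the number of vertices at odd positions, carry the
whole argument.

A unique shortest path `P` ending in `b` yields a layout in which exactly the vertices outside `P`
are at odd positions: with `d` the distance to `b`, put `v` at `2 * d v` if it is on `P` and at
`2 * d v - 1` otherwise (`Walk.IsUniqueShortestWalk.isLayout`). Uniqueness of `P` is what keeps a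
vertex outside `P` from being closer to `b` than its neighbours on `P`. Moreover, having a layout
with at most `s` vertices at odd positions passes to minors (`IsMinor.exists_isLayout`). When an edge
is contracted, the positions are squeezed by a `1`-Lipschitz map that identifies the positions of
its ends. If the ends are not both at even positions, this moves at most one vertex from an even to
an odd position, and only if the contraction has removed a vertex at an odd position. So a graph
with spectator floor `k` has a layout with at most `k` vertices at odd positions
(`exists_isLayout_ncard_oddSet_le`).

For a crowded parade with a path `P` on `p ≥ 2` vertices the layout of `P` is tight: it occupies
`0, 2, …, 2 * (p - 1)` and makes any two vertices at distance at most `2` adjacent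
(`IsCrowdedAlong.isTightLayout`). Hence any two distinct vertices are joined by a
path with at most `p - 1` edges, so they are at distance at most `2 * (p - 1)` in every layout, and
every layout has at most `p` vertices at even positions (`IsTightLayout.ncard_evenSet_le`). This
gives the spectator floor `n - p`. For `p = 1` and `m ≥ 2`, two vertices at even positions would be
joined by two edges.

For maximality, a graph `H` of the class that has `G` as a minor has as many vertices as `G`, so a
copy `K` of `G` is a spanning subgraph of `H`. A layout of `H` with at most `k` vertices at odd
positions is a layout of `K` with `p` vertices at even positions. Such an extremal layout agrees with
the tight one up to translation and reflection, except that for `m = 1` an end of the parade may be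
exchanged with a vertex outside it (`IsTightLayout.eq_of_extremes`,
`IsTightLayout.abs_sub_le_of_extremes`, `IsTightLayout.extremes_eq`). Therefore it leaves no room for
an edge of `H` outside `K` (`IsSaturatedCrowdedParade.eq_of_iso_of_le`).
-/

namespace SpectatorFloor

open scoped Graph

variable {α : Type u} {β : Type v} {α' : Type u'} {β' : Type v'}

/-! ### Layouts -/

/-- A layout of `G` places the vertices at integer positions: the even positions hold at most one
vertex each, adjacent vertices are at distance at most `2`, and two distinct vertices at even
positions are joined by at most one edge. The vertices of a parade occupy even positions, the
spectators odd ones; even positions may be empty. -/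
structure IsLayout (G : Graph α β) (f : α → ℤ) : Prop where
  eq_of_even : ∀ u ∈ V(G), ∀ v ∈ V(G), f u % 2 = 0 → f u = f v → u = v
  abs_sub_le : ∀ e u v, G.IsLink e u v → |f u - f v| ≤ 2
  edge_unique : ∀ e e' u v, G.IsLink e u v → G.IsLink e' u v → u ≠ v →
    f u % 2 = 0 → f v % 2 = 0 → e = e'

/-- The vertices at odd positions. -/
def oddSet (G : Graph α β) (f : α → ℤ) : Set α := {v ∈ V(G) | f v % 2 = 1}

/-- The vertices at even positions. -/
def evenSet (G : Graph α β) (f : α → ℤ) : Set α := {v ∈ V(G) | f v % 2 = 0}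

lemma ncard_oddSet_add_ncard_evenSet (G : Graph α β) (f : α → ℤ) (hfin : V(G).Finite) :
    (oddSet G f).ncard + (evenSet G f).ncard = V(G).ncard := by
  rw [← Set.ncard_union_eq (Set.disjoint_left.2 fun v h h' => by
    have := h.2; have := h'.2; omega) (hfin.subset fun v h => h.1) (hfin.subset fun v h => h.1)]
  congr 1
  ext v
  simp only [oddSet, evenSet, Set.mem_union, Set.mem_ofPred_eq]
  constructor
  · rintro (h | h) <;> exact h.1
  · intro h
    rcases Int.emod_two_eq_zero_or_one (f v) with h0 | h0 <;> simp [h, h0]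

lemma IsLayout.mono {G H : Graph α β} {f : α → ℤ} (hf : IsLayout H f) (hGH : G ≤ H) :
    IsLayout G f where
  eq_of_even u hu v hv := hf.eq_of_even u (hGH.vertexSet_mono hu) v (hGH.vertexSet_mono hv)
  abs_sub_le e u v h := hf.abs_sub_le e u v (hGH.isLink_mono h)
  edge_unique e e' u v h h' :=
    hf.edge_unique e e' u v (hGH.isLink_mono h) (hGH.isLink_mono h')

lemma IsLayout.neg {G : Graph α β} {f : α → ℤ} (hf : IsLayout G f) :
    IsLayout G (fun v => - f v) where
  eq_of_even u hu v hv h h' := hf.eq_of_even u hu v hv (by omega) (by omega)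
  abs_sub_le e u v h := by
    have := hf.abs_sub_le e u v h
    rw [abs_le] at *; omega
  edge_unique e e' u v h h' hne hu hv :=
    hf.edge_unique e e' u v h h' hne (by omega) (by omega)

lemma IsLayout.exists_of_iso {G : Graph α β} {K : Graph α' β'} (ψ : Iso G K) {f : α' → ℤ}
    (hf : IsLayout K f) : ∃ g : α → ℤ, IsLayout G g ∧ (∀ v : V(G), g v = f (ψ.vertexEquiv v)) ∧
      (oddSet G g).ncard = (oddSet K f).ncard := by
  classical
  set g : α → ℤ := fun v => if h : v ∈ V(G) then f (ψ.vertexEquiv ⟨v, h⟩) else 0 with hgdef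
  have hg : ∀ v (h : v ∈ V(G)), g v = f (ψ.vertexEquiv ⟨v, h⟩) := fun v h => by simp [hgdef, h]
  have hl : ∀ e u v (h : G.IsLink e u v), K.IsLink (ψ.edgeEquiv ⟨e, h.edge_mem⟩)
      (ψ.vertexEquiv ⟨u, h.left_mem⟩) (ψ.vertexEquiv ⟨v, h.right_mem⟩) :=
    fun e u v h => (ψ.isLink_iff ⟨e, h.edge_mem⟩ ⟨u, h.left_mem⟩ ⟨v, h.right_mem⟩).1 h
  refine ⟨g, ⟨?_, ?_, ?_⟩, fun v => hg v v.2, ?_⟩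
  · intro u hu v hv h0 h1
    rw [hg u hu, hg v hv] at h1
    rw [hg u hu] at h0
    have := hf.eq_of_even _ (ψ.vertexEquiv ⟨u, hu⟩).2 _ (ψ.vertexEquiv ⟨v, hv⟩).2 h0 h1
    simpa using ψ.vertexEquiv.injective (Subtype.ext this)
  · intro e u v h
    rw [hg u h.left_mem, hg v h.right_mem]
    exact hf.abs_sub_le _ _ _ (hl e u v h)
  · intro e e' u v h h' hne hu hv
    rw [hg u h.left_mem] at hu
    rw [hg v h.right_mem] at hv
    have := hf.edge_unique _ _ _ _ (hl e u v h) (hl e' u v h') (fun h0 => hne (by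
      simpa using ψ.vertexEquiv.injective (Subtype.ext h0))) hu hv
    simpa using ψ.edgeEquiv.injective (Subtype.ext this)
  · refine Set.ncard_congr (fun v hv => (ψ.vertexEquiv ⟨v, hv.1⟩ : α')) ?_ ?_ ?_
    · intro v hv
      exact ⟨(ψ.vertexEquiv ⟨v, hv.1⟩).2, by rw [← hg v hv.1]; exact hv.2⟩
    · intro v w hv hw h
      simpa using ψ.vertexEquiv.injective (Subtype.ext h)
    · intro w hw
      refine ⟨ψ.vertexEquiv.symm ⟨w, hw.1⟩, ⟨(ψ.vertexEquiv.symm ⟨w, hw.1⟩).2, ?_⟩, by simp⟩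
      rw [hg _ (ψ.vertexEquiv.symm ⟨w, hw.1⟩).2]
      simpa using hw.2

/-! ### Layouts of minors -/

/-- Contraction of an edge whose ends are not both at even positions: collapse an even position
`c` within distance `1` of both ends, so that the vertices at `c - 1`, `c` and `c + 1` all end up at
the odd position `c - 1` and those beyond move down by `2`. -/
lemma IsLayout.contractEdge_of_near {H : Graph α β} {f : α → ℤ} (hf : IsLayout H f)
    (hfin : V(H).Finite) {e : β} {x y : α} (he : H.IsLink e x y) (hxy : x ≠ y) {c : ℤ}
    (hc : c % 2 = 0) (hx : |f x - c| ≤ 1) (hy : |f y - c| ≤ 1) :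
    ∃ g, IsLayout (contractEdge H e x y) g ∧
      (oddSet (contractEdge H e x y) g).ncard ≤ (oddSet H f).ncard := by
  classical
  rw [abs_le] at hx hy
  set g : α → ℤ := fun v => if f v < c then f v else if f v = c then c - 1 else f v - 2 with hgdef
  have hg : ∀ v, (f v < c ∧ g v = f v) ∨ (f v = c ∧ g v = c - 1) ∨ (c < f v ∧ g v = f v - 2) := by
    intro v
    simp only [hgdef]
    split_ifs <;> omega
  have hgx : g x = c - 1 := by have := hg x; omega
  have hgy : g y = c - 1 := by have := hg y; omega
  have hV : ∀ v, v ∈ V(contractEdge H e x y) → v ∈ V(H) ∧ v ≠ y := by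
    rintro v ⟨w, hw, rfl⟩
    dsimp only
    split_ifs with h
    · exact ⟨he.left_mem, hxy⟩
    · exact ⟨hw, h⟩
  have hφ : ∀ v, g (if v = y then x else v) = g v := by
    intro v
    split_ifs with h
    · rw [h, hgx, hgy]
    · rfl
  refine ⟨g, ⟨?_, ?_, ?_⟩, ?_⟩
  · intro u hu v hv h0 h1
    have h2 := hg u
    have h3 := hg v
    exact hf.eq_of_even u (hV u hu).1 v (hV v hv).1 (by omega) (by omega)
  · rintro e' - - ⟨u, v, h, rfl, rfl⟩
    rw [hφ, hφ]
    have := hf.abs_sub_le _ _ _ h.1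
    rw [abs_le] at *
    have h2 := hg u
    have h3 := hg v
    omega
  · have key : ∀ e' u v, (contractEdge H e x y).IsLink e' u v → g u % 2 = 0 → g v % 2 = 0 →
        H.IsLink e' u v := by
      rintro e' - - ⟨u, v, h, rfl, rfl⟩ h0 h1
      rw [hφ] at h0 h1
      have hu : u ≠ y := by rintro rfl; omega
      have hv : v ≠ y := by rintro rfl; omega
      simpa [hu, hv] using h.1
    intro e₁ e₂ u v h1 h2 hne hu hv
    have h3 := hg u
    have h4 := hg v
    exact hf.edge_unique e₁ e₂ u v (key _ _ _ h1 hu hv) (key _ _ _ h2 hu hv) hne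
      (by omega) (by omega)
  · have hofin : (oddSet H f).Finite := hfin.subset fun v hv => hv.1
    have hsub : ∀ v ∈ oddSet (contractEdge H e x y) g, v ≠ y ∧ v ∈ V(H) ∧
        (f v = c ∨ v ∈ oddSet H f) := by
      intro v hv
      obtain ⟨h1, h2⟩ := hV v hv.1
      refine ⟨h2, h1, ?_⟩
      by_cases h3 : f v = c
      · exact Or.inl h3
      · have h4 := hg v
        have h5 := hv.2
        exact Or.inr ⟨h1, by omega⟩
    by_cases hyc : f y = c
    · refine Set.ncard_le_ncard (fun v hv => ?_) hofin
      obtain ⟨h1, h2, h3 | h3⟩ := hsub v hv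
      · exact absurd (hf.eq_of_even v h2 y he.right_mem (by omega) (by omega)) h1
      · exact h3
    · -- the odd position of `y` is freed, so one vertex may move to an odd position
      have hyo : y ∈ oddSet H f := ⟨he.right_mem, by omega⟩
      obtain ⟨w, hw⟩ : ∃ w, ∀ v ∈ V(H), f v = c → v = w := by
        by_cases h : ∃ w ∈ V(H), f w = c
        · obtain ⟨w, hw, hw'⟩ := h
          exact ⟨w, fun v hv hv' => hf.eq_of_even v hv w hw (by omega) (by omega)⟩
        · push Not at h
          exact ⟨y, fun v hv hv' => absurd hv' (h v hv)⟩
      have h1 : oddSet (contractEdge H e x y) g ⊆ insert w (oddSet H f \ {y}) := by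
        intro v hv
        obtain ⟨h1, h2, h3 | h3⟩ := hsub v hv
        · exact Or.inl (hw v h2 h3)
        · exact Or.inr ⟨h3, h1⟩
      calc _ ≤ (insert w (oddSet H f \ {y})).ncard :=
            Set.ncard_le_ncard h1 ((hofin.sdiff).insert w)
        _ ≤ (oddSet H f \ {y}).ncard + 1 := Set.ncard_insert_le _ _
        _ = _ := Set.ncard_sdiff_singleton_add_one hyo hofin

/-- Contraction of an edge joining the even positions `c` and `c + 2`: all positions from `c + 2`
on move down by `2`. -/
lemma IsLayout.contractEdge_of_even {H : Graph α β} {f : α → ℤ} (hf : IsLayout H f)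
    (hfin : V(H).Finite) {e : β} {x y : α} (he : H.IsLink e x y) {c : ℤ}
    (hc : c % 2 = 0) (hxy : f x = c ∧ f y = c + 2 ∨ f x = c + 2 ∧ f y = c) :
    ∃ g, IsLayout (contractEdge H e x y) g ∧
      (oddSet (contractEdge H e x y) g).ncard ≤ (oddSet H f).ncard := by
  classical
  have hne : x ≠ y := by rintro rfl; omega
  set g : α → ℤ := fun v => if f v ≤ c + 1 then f v else f v - 2 with hgdef
  have hg : ∀ v, (f v ≤ c + 1 ∧ g v = f v) ∨ (c + 1 < f v ∧ g v = f v - 2) := by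
    intro v
    simp only [hgdef]
    split_ifs <;> omega
  have hgx : g x = c := by have := hg x; omega
  have hgy : g y = c := by have := hg y; omega
  have hV : ∀ v, v ∈ V(contractEdge H e x y) → v ∈ V(H) ∧ v ≠ y := by
    rintro v ⟨w, hw, rfl⟩
    dsimp only
    split_ifs with h
    · exact ⟨he.left_mem, hne⟩
    · exact ⟨hw, h⟩
  have hφ : ∀ v, g (if v = y then x else v) = g v := by
    intro v
    split_ifs with h
    · rw [h, hgx, hgy]
    · rfl
  have hcc : ∀ v ∈ V(H), f v = c ∨ f v = c + 2 → v = x ∨ v = y := by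
    intro v hv h
    rcases hxy with ⟨h1, h2⟩ | ⟨h1, h2⟩ <;> rcases h with h | h
    · exact Or.inl (hf.eq_of_even v hv x he.left_mem (by omega) (by omega))
    · exact Or.inr (hf.eq_of_even v hv y he.right_mem (by omega) (by omega))
    · exact Or.inr (hf.eq_of_even v hv y he.right_mem (by omega) (by omega))
    · exact Or.inl (hf.eq_of_even v hv x he.left_mem (by omega) (by omega))
  refine ⟨g, ⟨?_, ?_, ?_⟩, ?_⟩
  · intro u hu v hv h0 h1
    have h2 := hg u
    have h3 := hg v
    obtain ⟨hu1, hu2⟩ := hV u hu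
    obtain ⟨hv1, hv2⟩ := hV v hv
    by_cases h4 : f u = f v
    · exact hf.eq_of_even u hu1 v hv1 (by omega) h4
    · have h5 := hcc u hu1 (by omega)
      have h6 := hcc v hv1 (by omega)
      exact (h5.resolve_right hu2).trans (h6.resolve_right hv2).symm
  · rintro e' - - ⟨u, v, h, rfl, rfl⟩
    rw [hφ, hφ]
    have := hf.abs_sub_le _ _ _ h.1
    rw [abs_le] at *
    have h2 := hg u
    have h3 := hg v
    omega
  · -- no vertex at an even position is adjacent to both `x` and `y`
    have hno : ∀ e₁ e₂ v, H.IsLink e₁ x v → H.IsLink e₂ y v → f v % 2 = 0 → v = x ∨ v = y := by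
      intro e₁ e₂ v h1 h2 h3
      have h4 := hf.abs_sub_le _ _ _ h1
      have h5 := hf.abs_sub_le _ _ _ h2
      rw [abs_le] at h4 h5
      exact hcc v h1.right_mem (by omega)
    -- hence an edge of the contraction between even positions has the same ends in `H` as any
    -- edge parallel to it
    have aux : ∀ e₁ e₂ u₁ u₂ v₁ v₂, H.IsLink e₁ u₁ v₁ → H.IsLink e₂ u₂ v₂ →
        (if u₁ = y then x else u₁) = (if u₂ = y then x else u₂) →
        (if v₁ = y then x else v₁) = (if v₂ = y then x else v₂) →
        (if u₁ = y then x else u₁) ≠ (if v₁ = y then x else v₁) →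
        f u₁ % 2 = 0 → f v₁ % 2 = 0 → u₁ = u₂ ∧ v₁ = v₂ := by
      intro e₁ e₂ u₁ u₂ v₁ v₂ h1 h2 hu hv hne' hfu hfv
      have n1 := hno e₁ e₂ v₁
      have n2 := hno e₂ e₁ v₁
      have n3 := hno e₁ e₂ u₁
      have n4 := hno e₂ e₁ u₁
      have s1 := h1.symm
      have s2 := h2.symm
      grind
    rintro e₁ e₂ u v ⟨u₁, v₁, h1, rfl, rfl⟩ ⟨u₂, v₂, h2, hu, hv⟩ hne' h0u h0v
    rw [hφ] at h0u h0v
    have h3 := hg u₁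
    have h4 := hg v₁
    obtain ⟨rfl, rfl⟩ := aux e₁ e₂ u₁ u₂ v₁ v₂ h1.1 h2.1 hu.symm hv.symm hne' (by omega) (by omega)
    exact hf.edge_unique e₁ e₂ _ _ h1.1 h2.1 (by rintro rfl; exact hne' rfl) (by omega) (by omega)
  · refine Set.ncard_le_ncard (fun v hv => ⟨(hV v hv.1).1, ?_⟩) (hfin.subset fun v hv => hv.1)
    have h1 := hg v
    have h2 := hv.2
    omega

lemma contractEdge_self_le (H : Graph α β) (e : β) (x : α) : contractEdge H e x x ≤ H := by
  classical
  unfold contractEdge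
  convert Graph.deleteEdges_le (G := H) (F := {e}) using 1
  rw [show (fun z => if z = x then x else z) = (id : α → α) by
    funext z
    by_cases h : z = x <;> simp [h], Graph.map_id]

lemma oddSet_ncard_mono {G H : Graph α β} (hGH : G ≤ H) (hfin : V(H).Finite) (f : α → ℤ) :
    (oddSet G f).ncard ≤ (oddSet H f).ncard :=
  Set.ncard_le_ncard (fun _ hv => ⟨hGH.vertexSet_mono hv.1, hv.2⟩) (hfin.subset fun _ hv => hv.1)

lemma IsElementaryMinor.finite {G H : Graph α β} (h : IsElementaryMinor G H)
    (hfin : V(H).Finite) : V(G).Finite := by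
  cases h with
  | deleteVertex _ x hx hiso => exact hfin.subset (Graph.deleteVerts_le.vertexSet_mono)
  | deleteEdge _ e he => exact hfin
  | contract _ e x y he hpar => exact hfin.image _

lemma IsElementaryMinor.exists_isLayout {G H : Graph α β} (h : IsElementaryMinor G H)
    (hfin : V(H).Finite) {f : α → ℤ} (hf : IsLayout H f) :
    ∃ g, IsLayout G g ∧ (oddSet G g).ncard ≤ (oddSet H f).ncard := by
  cases h with
  | deleteVertex _ x hx hiso =>
    exact ⟨f, hf.mono Graph.deleteVerts_le, oddSet_ncard_mono Graph.deleteVerts_le hfin f⟩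
  | deleteEdge _ e he =>
    exact ⟨f, hf.mono Graph.deleteEdges_le, oddSet_ncard_mono Graph.deleteEdges_le hfin f⟩
  | contract _ e x y he hpar =>
    by_cases hxy : x = y
    · subst hxy
      exact ⟨f, hf.mono (contractEdge_self_le H e x),
        oddSet_ncard_mono (contractEdge_self_le H e x) hfin f⟩
    have h2 := hf.abs_sub_le _ _ _ he
    rw [abs_le] at h2
    rcases Int.emod_two_eq_zero_or_one (f x) with hx | hx <;>
    rcases Int.emod_two_eq_zero_or_one (f y) with hy | hy
    · have hne : f x ≠ f y := fun h => hxy (hf.eq_of_even x he.left_mem y he.right_mem hx h)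
      rcases lt_or_gt_of_ne hne with h3 | h3
      · exact hf.contractEdge_of_even hfin he (c := f x) hx (by omega)
      · exact hf.contractEdge_of_even hfin he (c := f y) hy (by omega)
    · exact hf.contractEdge_of_near hfin he hxy (c := f x) hx (by rw [abs_le]; omega)
        (by rw [abs_le]; omega)
    · exact hf.contractEdge_of_near hfin he hxy (c := f y) hy (by rw [abs_le]; omega)
        (by rw [abs_le]; omega)
    · exact hf.contractEdge_of_near hfin he hxy (c := min (f x) (f y) + 1) (by omega)
        (by rw [abs_le]; omega) (by rw [abs_le]; omega)

/-- Having a layout with at most `s` vertices at odd positions passes to minors. -/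
lemma IsMinor.exists_isLayout {G : Graph α β} {H : Graph α' β'} (h : IsMinor G H)
    (hfin : V(H).Finite) {f : α' → ℤ} (hf : IsLayout H f) :
    ∃ g, IsLayout G g ∧ (oddSet G g).ncard ≤ (oddSet H f).ncard := by
  obtain ⟨K, hHK, ⟨ψ⟩⟩ := h
  have : V(K).Finite ∧ ∃ g, IsLayout K g ∧ (oddSet K g).ncard ≤ (oddSet H f).ncard := by
    clear ψ
    induction hHK with
    | refl => exact ⟨hfin, f, hf, le_rfl⟩
    | tail _ hstep ih =>
      obtain ⟨hfin', g, hg, hle⟩ := ih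
      obtain ⟨g', hg', hle'⟩ := hstep.exists_isLayout hfin' hg
      exact ⟨hstep.finite hfin', g', hg', hle'.trans hle⟩
  obtain ⟨-, g, hg, hle⟩ := this
  obtain ⟨g', hg', -, hcard⟩ := hg.exists_of_iso ψ
  exact ⟨g', hg', hcard.trans_le hle⟩

/-- An elementary minor with no fewer vertices is a spanning subgraph. -/
lemma IsElementaryMinor.le_or_ncard_lt {G H : Graph α β} (h : IsElementaryMinor G H)
    (hfin : V(H).Finite) : (G ≤ H ∧ V(G) = V(H)) ∨ V(G).ncard < V(H).ncard := by
  cases h with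
  | deleteVertex _ x hx hiso =>
    refine Or.inr (Set.ncard_lt_ncard ⟨Graph.deleteVerts_le.vertexSet_mono, fun h => ?_⟩ hfin)
    simpa using h hx
  | deleteEdge _ e he => exact Or.inl ⟨Graph.deleteEdges_le, rfl⟩
  | contract _ e x y he hpar =>
    by_cases hxy : x = y
    · subst hxy
      refine Or.inl ⟨contractEdge_self_le H e x, ?_⟩
      refine (contractEdge_self_le H e x).vertexSet_mono.antisymm fun v hv => ⟨v, hv, ?_⟩
      by_cases h : v = x <;> simp [h]
    · have hsub : V(contractEdge H e x y) ⊆ V(H) \ {y} := by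
        rintro v ⟨w, hw, rfl⟩
        dsimp only
        split_ifs with h
        · exact ⟨he.left_mem, hxy⟩
        · exact ⟨hw, h⟩
      exact Or.inr ((Set.ncard_le_ncard hsub hfin.sdiff).trans_lt
        (Set.ncard_sdiff_singleton_lt_of_mem he.right_mem hfin))

lemma le_or_ncard_lt_of_reflTransGen {H K : Graph α β}
    (h : Relation.ReflTransGen (fun A B => IsElementaryMinor B A) H K) (hfin : V(H).Finite) :
    V(K).Finite ∧ ((K ≤ H ∧ V(K) = V(H)) ∨ V(K).ncard < V(H).ncard) := by
  induction h with
  | refl => exact ⟨hfin, Or.inl ⟨le_rfl, rfl⟩⟩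
  | tail _ hstep ih =>
    obtain ⟨hfin', ih⟩ := ih
    refine ⟨hstep.finite hfin', ?_⟩
    rcases hstep.le_or_ncard_lt hfin' with ⟨h1, h2⟩ | h1 <;> rcases ih with ⟨h3, h4⟩ | h3
    · exact Or.inl ⟨h1.trans h3, h2.trans h4⟩
    · exact Or.inr (by rwa [h2])
    · exact Or.inr (by rwa [← h4])
    · exact Or.inr (h1.trans h3)

/-! ### Unique shortest paths and distances -/

namespace Walk

variable {G : Graph α β}

@[simp] lemma length_nil (x : α) (hx : x ∈ V(G)) : (nil x hx : Walk G x x).length = 0 := rfl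

@[simp] lemma length_cons {x y z : α} (e : β) (h : G.IsLink e x y) (w : Walk G y z) :
    (cons e h w).length = w.length + 1 := rfl

lemma length_support {x y : α} (w : Walk G x y) : w.support.length = w.order := by
  induction w with
  | nil x hx => rfl
  | cons e h w ih => simp only [support, order, List.length_cons, ih, length_cons]

lemma mem_vertexSet_of_mem_support {x y z : α} (w : Walk G x y) (hz : z ∈ w.support) :
    z ∈ V(G) := by
  induction w with
  | nil x hx => simp only [support, List.mem_singleton] at hz; exact hz ▸ hx
  | cons e h w ih =>
    rcases List.mem_cons.1 hz with rfl | hz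
    · exact h.left_mem
    · exact ih hz

lemma start_mem_support {x y : α} (w : Walk G x y) : x ∈ w.support := by
  cases w <;> simp [support]

lemma mem_support_of_mem_edges {x y u v : α} {e : β} (w : Walk G x y) (he : e ∈ w.edges)
    (huv : G.IsLink e u v) : u ∈ w.support := by
  induction w with
  | nil x hx => simp [edges] at he
  | cons e' h w ih =>
    rcases List.mem_cons.1 he with rfl | he
    · rcases huv.left_eq_or_eq h with rfl | rfl
      · simp [support]
      · exact List.mem_cons_of_mem _ w.start_mem_support
    · exact List.mem_cons_of_mem _ (ih he)

lemma IsPath.order_le {x y : α} {w : Walk G x y} (hw : w.IsPath) (hfin : V(G).Finite) :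
    w.order ≤ V(G).ncard := by
  classical
  rw [← w.length_support, ← List.toFinset_card_of_nodup hw, ← Set.ncard_coe_finset]
  exact Set.ncard_le_ncard (fun z hz => w.mem_vertexSet_of_mem_support (by simpa using hz)) hfin

/-- The part of a walk from a vertex it visits. -/
lemma exists_suffix {x y z : α} (w : Walk G x y) (hz : z ∈ w.support) :
    ∃ w' : Walk G z y, w'.length ≤ w.length ∧ w'.support <:+ w.support := by
  induction w with
  | nil x hx =>
    simp only [support, List.mem_singleton] at hz
    subst hz
    exact ⟨nil z hx, le_rfl, List.suffix_refl _⟩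
  | @cons c _ _ e h w ih =>
    by_cases hzx : z = c
    · subst hzx
      exact ⟨cons e h w, le_rfl, List.suffix_refl _⟩
    · obtain ⟨w', h1, h2⟩ := ih ((List.mem_cons.1 hz).resolve_left hzx)
      exact ⟨w', h1.trans (Nat.le_succ _), h2.trans (List.suffix_cons _ _)⟩

/-- A walk contains a path with the same ends, which is shorter unless the walk is a path. -/
lemma exists_isPath {x y : α} (w : Walk G x y) :
    ∃ w' : Walk G x y, w'.IsPath ∧ w'.length ≤ w.length ∧ (w.IsPath ∨ w'.length < w.length) := by
  induction w with
  | nil x hx =>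
    exact ⟨nil x hx, by simp [IsPath, support], le_rfl, Or.inl (by simp [IsPath, support])⟩
  | @cons a b c e h w ih =>
    obtain ⟨p, hp, hle, hlt⟩ := ih
    by_cases ha : a ∈ p.support
    · obtain ⟨q, hq, hqs⟩ := p.exists_suffix ha
      exact ⟨q, hp.sublist hqs.sublist, by rw [length_cons]; omega,
        Or.inr (by rw [length_cons]; omega)⟩
    · have hcp : (cons e h p).IsPath := List.nodup_cons.2 ⟨ha, hp⟩
      rcases hlt with hlt | hlt
      · by_cases ha' : a ∈ w.support
        · obtain ⟨q, hq, hqs⟩ := w.exists_suffix ha'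
          exact ⟨q, hlt.sublist hqs.sublist, by rw [length_cons]; omega,
            Or.inr (by rw [length_cons]; omega)⟩
        · exact ⟨cons e h w, List.nodup_cons.2 ⟨ha', hlt⟩, le_rfl,
            Or.inl (List.nodup_cons.2 ⟨ha', hlt⟩)⟩
      · exact ⟨cons e h p, hcp, by rw [length_cons, length_cons]; omega,
          Or.inr (by rw [length_cons, length_cons]; omega)⟩

/-- No other walk, path or not, with the same ends is at most as long. -/
def IsUniqueShortestWalk {x y : α} (w : Walk G x y) : Prop :=
  ∀ w' : Walk G x y, w'.length ≤ w.length → w' = w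

lemma IsUniqueShortestPath.isUniqueShortestWalk {x y : α} {w : Walk G x y}
    (hw : w.IsUniqueShortestPath) : w.IsUniqueShortestWalk := by
  intro w' hle
  obtain ⟨⟨hp, hshort⟩, huniq⟩ := hw
  obtain ⟨p, hpp, hle', hlt⟩ := w'.exists_isPath
  have h1 := hshort p hpp
  simp only [order] at h1
  rcases hlt with hlt | hlt
  · exact huniq w' hlt (by simp only [order]; omega)
  · omega

lemma IsUniqueShortestWalk.of_cons {x y z : α} {e : β} {h : G.IsLink e x y} {w : Walk G y z}
    (hw : (cons e h w).IsUniqueShortestWalk) : w.IsUniqueShortestWalk := by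
  intro w' hle
  have := hw (cons e h w') (by rw [length_cons, length_cons]; omega)
  simpa using this

end Walk

/-- The distance from `v` to `b`, with value `0` when there is no walk from `v` to `b`. -/
noncomputable def distTo (G : Graph α β) (b v : α) : ℕ :=
  sInf {l : ℕ | ∃ w : Walk G v b, w.length = l}

section distTo

variable {G : Graph α β} {b : α}

lemma exists_length_eq_distTo {v : α} (w : Walk G v b) :
    ∃ w' : Walk G v b, w'.length = distTo G b v :=
  Nat.sInf_mem (s := {l : ℕ | ∃ w : Walk G v b, w.length = l}) ⟨_, w, rfl⟩

lemma distTo_le {v : α} (w : Walk G v b) : distTo G b v ≤ w.length :=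
  Nat.sInf_le ⟨w, rfl⟩

lemma distTo_le_succ {e : β} {u v : α} (h : G.IsLink e u v) :
    distTo G b u ≤ distTo G b v + 1 := by
  by_cases hv : Nonempty (Walk G v b)
  · obtain ⟨w, hw⟩ := exists_length_eq_distTo hv.some
    rw [← hw]
    exact distTo_le (Walk.cons e h w)
  · have : {l : ℕ | ∃ w : Walk G u b, w.length = l} = ∅ := by
      refine Set.eq_empty_iff_forall_notMem.2 ?_
      rintro l ⟨w, -⟩
      exact hv ⟨Walk.cons e h.symm w⟩
    simp [distTo, this]

lemma Walk.IsUniqueShortestWalk.distTo_eq {v : α} {w : Walk G v b} (hw : w.IsUniqueShortestWalk) :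
    distTo G b v = w.length := by
  obtain ⟨w', hw'⟩ := exists_length_eq_distTo w
  have h1 := distTo_le w
  rw [← hw', hw w' (by omega)]

namespace Walk.IsUniqueShortestWalk

variable {a : α} {P : Walk G a b}

lemma exists_suffix (hP : P.IsUniqueShortestWalk) {q : α} (hq : q ∈ P.support) :
    ∃ R : Walk G q b, R.IsUniqueShortestWalk ∧ R.support ⊆ P.support ∧ R.length ≤ P.length := by
  induction P with
  | nil x hx =>
    simp only [support, List.mem_singleton] at hq
    subst hq
    exact ⟨nil q hx, hP, fun _ h => h, le_rfl⟩
  | @cons c _ _ e h w ih =>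
    by_cases hqx : q = c
    · subst hqx
      exact ⟨cons e h w, hP, fun _ h => h, le_rfl⟩
    · obtain ⟨R, h1, h2, h3⟩ := ih hP.of_cons ((List.mem_cons.1 hq).resolve_left hqx)
      exact ⟨R, h1, fun z hz => List.mem_cons_of_mem _ (h2 hz), by rw [length_cons]; omega⟩

lemma distTo_le_length (hP : P.IsUniqueShortestWalk) {q : α} (hq : q ∈ P.support) :
    distTo G b q ≤ P.length := by
  obtain ⟨R, h1, -, h3⟩ := hP.exists_suffix hq
  rwa [h1.distTo_eq]

lemma distTo_injOn (hP : P.IsUniqueShortestWalk) {q q' : α} (hq : q ∈ P.support)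
    (hq' : q' ∈ P.support) (h : distTo G b q = distTo G b q') : q = q' := by
  induction P with
  | nil x hx =>
    simp only [support, List.mem_singleton] at hq hq'
    rw [hq, hq']
  | cons e hl w ih =>
    have h1 := hP.distTo_eq
    rw [length_cons] at h1
    rcases List.mem_cons.1 hq with hqx | hqw <;> rcases List.mem_cons.1 hq' with hqx' | hqw'
    · rw [hqx, hqx']
    · have := hP.of_cons.distTo_le_length hqw'
      rw [hqx] at h
      omega
    · have := hP.of_cons.distTo_le_length hqw
      rw [hqx'] at h
      omega
    · exact ih hP.of_cons hqw hqw' h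

lemma exists_distTo_eq (hP : P.IsUniqueShortestWalk) {i : ℕ} (hi : i ≤ P.length) :
    ∃ q ∈ P.support, distTo G b q = i := by
  induction P with
  | nil x hx =>
    exact ⟨x, by simp [support], by rw [hP.distTo_eq]; simp at hi ⊢; omega⟩
  | cons e h w ih =>
    by_cases h1 : i ≤ w.length
    · obtain ⟨q, hq, hqi⟩ := ih hP.of_cons h1
      exact ⟨q, List.mem_cons_of_mem _ hq, hqi⟩
    · exact ⟨_, List.mem_cons_self, by rw [hP.distTo_eq]; simp at hi ⊢; omega⟩

/-- Any edge that leads from a vertex of `P` closer to `b` starts the part of `P` from there. -/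
lemma distTo_succ_unique (hP : P.IsUniqueShortestWalk) {q x x' : α} {e e' : β}
    (hq : q ∈ P.support) (h : G.IsLink e q x) (hx : distTo G b x + 1 = distTo G b q)
    (h' : G.IsLink e' q x') (hx' : distTo G b x' + 1 = distTo G b q) :
    x ∈ P.support ∧ e = e' := by
  obtain ⟨R, h1, h2, -⟩ := hP.exists_suffix hq
  obtain ⟨w, hw⟩ : ∃ w : Walk G x b, w.length = distTo G b x :=
    exists_length_eq_distTo (Walk.cons e h.symm R)
  obtain ⟨w', hw'⟩ : ∃ w : Walk G x' b, w.length = distTo G b x' :=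
    exists_length_eq_distTo (Walk.cons e' h'.symm R)
  have h3 := h1.distTo_eq
  have h4 := h1 (Walk.cons e h w) (by rw [length_cons]; omega)
  have h5 := h1 (Walk.cons e' h' w') (by rw [length_cons]; omega)
  constructor
  · refine h2 ?_
    rw [← h4]
    exact List.mem_cons_of_mem _ w.start_mem_support
  · have h6 := h4.trans h5.symm
    injection h6

lemma adj_of_distTo_succ (hP : P.IsUniqueShortestWalk) {q q' : α} (hq : q ∈ P.support)
    (hq' : q' ∈ P.support) (h : distTo G b q' + 1 = distTo G b q) : G.Adj q q' := by
  obtain ⟨R, h1, h2, -⟩ := hP.exists_suffix hq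
  have h3 := h1.distTo_eq
  cases R with
  | nil x hx => simp at h3; omega
  | cons e hl w =>
    have h4 := h1.of_cons.distTo_eq
    rw [length_cons] at h3
    have := hP.distTo_injOn (h2 (List.mem_cons_of_mem _ w.start_mem_support)) hq' (by omega)
    exact this ▸ ⟨e, hl⟩

end Walk.IsUniqueShortestWalk

end distTo

open Classical in
/-- The position of a vertex relative to a walk `P` ending in `b`: twice the distance to `b` for
the vertices of `P`, and one less for the others. -/
noncomputable def position (G : Graph α β) {a b : α} (P : Walk G a b) (v : α) : ℤ :=
  if v ∈ P.support then 2 * (distTo G b v : ℤ) else 2 * (distTo G b v : ℤ) - 1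

section position

variable {G : Graph α β} {a b : α} {P : Walk G a b}

lemma position_of_mem {v : α} (hv : v ∈ P.support) : position G P v = 2 * (distTo G b v : ℤ) := by
  simp [position, hv]

lemma position_of_notMem {v : α} (hv : v ∉ P.support) :
    position G P v = 2 * (distTo G b v : ℤ) - 1 := by
  simp [position, hv]

lemma position_even_iff {v : α} : position G P v % 2 = 0 ↔ v ∈ P.support := by
  by_cases hv : v ∈ P.support
  · simp [position_of_mem hv, hv]
  · simp only [position_of_notMem hv, hv, iff_false]
    omega

/-- Uniqueness of `P` keeps a vertex outside `P` from lying closer to `b` than its neighbours on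
`P`, so the positions relative to `P` form a layout. -/
lemma Walk.IsUniqueShortestWalk.isLayout (hP : P.IsUniqueShortestWalk) :
    IsLayout G (position G P) where
  eq_of_even u hu v hv h0 h := by
    have hu' := position_even_iff.1 h0
    have hv' := position_even_iff.1 (h ▸ h0)
    rw [position_of_mem hu', position_of_mem hv'] at h
    exact hP.distTo_injOn hu' hv' (by omega)
  abs_sub_le e u v h := by
    have h1 := distTo_le_succ (b := b) h
    have h2 := distTo_le_succ (b := b) h.symm
    rw [abs_le]
    by_cases hu : u ∈ P.support <;> by_cases hv : v ∈ P.support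
    · rw [position_of_mem hu, position_of_mem hv]; omega
    · rw [position_of_mem hu, position_of_notMem hv]
      have h3 : distTo G b v + 1 ≠ distTo G b u := fun h3 =>
        hv (hP.distTo_succ_unique hu h h3 h h3).1
      omega
    · rw [position_of_notMem hu, position_of_mem hv]
      have h3 : distTo G b u + 1 ≠ distTo G b v := fun h3 =>
        hu (hP.distTo_succ_unique hv h.symm h3 h.symm h3).1
      omega
    · rw [position_of_notMem hu, position_of_notMem hv]; omega
  edge_unique e e' u v h h' hne h0 h0' := by
    have hu := position_even_iff.1 h0
    have hv := position_even_iff.1 h0'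
    have h1 := distTo_le_succ (b := b) h
    have h2 := distTo_le_succ (b := b) h.symm
    have h3 : distTo G b u ≠ distTo G b v := fun h3 => hne (hP.distTo_injOn hu hv h3)
    rcases lt_or_gt_of_ne h3 with h4 | h4
    · exact (hP.distTo_succ_unique hv h.symm (by omega) h'.symm (by omega)).2
    · exact (hP.distTo_succ_unique hu h (by omega) h' (by omega)).2

lemma ncard_evenSet_position (hP : P.IsPath) : (evenSet G (position G P)).ncard = P.order := by
  classical
  rw [← P.length_support, ← List.toFinset_card_of_nodup hP, ← Set.ncard_coe_finset]
  congr 1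
  ext v
  simp only [evenSet, Set.mem_ofPred_eq, position_even_iff, Finset.mem_coe, List.mem_toFinset]
  exact ⟨fun h => h.2, fun h => ⟨P.mem_vertexSet_of_mem_support h, h⟩⟩

end position

/-! ### The spectator number -/

lemma order_le_paradeNumber {G : Graph α β} (hfin : V(G).Finite) {a b : α} {P : Walk G a b}
    (hP : P.IsUniqueShortestPath) : P.order ≤ paradeNumber G := by
  refine le_csSup ⟨V(G).ncard, ?_⟩ ⟨a, b, P, hP, rfl⟩
  rintro p ⟨x, y, w, hw, rfl⟩
  exact hw.1.1.order_le hfin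

lemma isUniqueShortestPath_nil {G : Graph α β} {x : α} (hx : x ∈ V(G)) :
    (Walk.nil x hx : Walk G x x).IsUniqueShortestPath := by
  refine ⟨⟨by simp [Walk.IsPath, Walk.support], fun w _ => Nat.succ_le_succ (Nat.zero_le _)⟩, ?_⟩
  intro w _ hw
  cases w with
  | nil => rfl
  | cons e h w => simp [Walk.order] at hw

/-- A graph with spectator number `s` has a layout with `s` vertices at odd positions. -/
lemma exists_isLayout_ncard_oddSet_eq {G : Graph α β} (hne : V(G).Nonempty)
    (hfin : V(G).Finite) :
    ∃ f, IsLayout G f ∧ (oddSet G f).ncard = spectatorNumber G := by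
  obtain ⟨x, hx⟩ := hne
  obtain ⟨a, b, P, hP, hord⟩ : paradeNumber G ∈ {p : ℕ | ∃ (x y : α) (w : Walk G x y),
      w.IsUniqueShortestPath ∧ w.order = p} := by
    refine Nat.sSup_mem ⟨_, x, x, _, isUniqueShortestPath_nil hx, rfl⟩ ⟨V(G).ncard, ?_⟩
    rintro p ⟨x, y, w, hw, rfl⟩
    exact hw.1.1.order_le hfin
  refine ⟨position G P, hP.isUniqueShortestWalk.isLayout, ?_⟩
  have h1 := ncard_oddSet_add_ncard_evenSet G (position G P) hfin
  rw [ncard_evenSet_position hP.1.1, hord] at h1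
  rw [spectatorNumber]
  omega

/-- The spectator floor of `G` is the spectator number of some `H` having `G` as a minor; a layout
of `H` with that many vertices at odd positions induces the required layout of `G`. -/
lemma exists_isLayout_ncard_oddSet_le {G : Graph α β} (hG : IsMultigraph G) :
    ∃ f, IsLayout G f ∧ (oddSet G f).ncard ≤ spectatorFloor G := by
  have : spectatorFloor G ∈ {s : ℕ | ∃ (α' : Type u) (β' : Type v) (H : Graph α' β'),
      IsMultigraph H ∧ IsMinor G H ∧ spectatorNumber H = s} :=
    Nat.sInf_mem ⟨_, α, β, G, hG, ⟨G, .refl, ⟨⟨.refl _, .refl _, fun _ _ _ => Iff.rfl⟩⟩⟩, rfl⟩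
  obtain ⟨α', β', H, hH, hmin, hs⟩ := this
  obtain ⟨f, hf, hcard⟩ := exists_isLayout_ncard_oddSet_eq hH.nonempty hH.finite_vertexSet
  obtain ⟨g, hg, hle⟩ := hmin.exists_isLayout hH.finite_vertexSet hf
  exact ⟨g, hg, hle.trans (hcard.trans hs).le⟩

lemma spectatorFloor_le_spectatorNumber {G : Graph α β} (hG : IsMultigraph G) :
    spectatorFloor G ≤ spectatorNumber G :=
  Nat.sInf_le ⟨α, β, G, hG, ⟨G, .refl, ⟨⟨.refl _, .refl _, fun _ _ _ => Iff.rfl⟩⟩⟩, rfl⟩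

/-! ### Tight layouts -/

/-- A layout at the positions `0, …, 2 * L` that occupies all even ones of these, makes all vertices
at distance at most `2` adjacent, and has `m` edges between any two adjacent vertices that are not
both at even positions. -/
structure IsTightLayout (G : Graph α β) (m : ℕ) (L : ℤ) (g : α → ℤ) : Prop
    extends IsLayout G g where
  nonneg : ∀ v ∈ V(G), 0 ≤ g v
  le : ∀ v ∈ V(G), g v ≤ 2 * L
  exists_even : ∀ i : ℤ, 0 ≤ i → i ≤ L → ∃ v ∈ V(G), g v = 2 * i
  adj : ∀ u ∈ V(G), ∀ v ∈ V(G), u ≠ v → |g u - g v| ≤ 2 → G.Adj u v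
  multiplicity_eq : ∀ u v, G.Adj u v → ¬ (g u % 2 = 0 ∧ g v % 2 = 0) → multiplicity G u v = m

lemma IsLayout.multiplicity_le_one {G : Graph α β} {f : α → ℤ} (hf : IsLayout G f) {u v : α}
    (hne : u ≠ v) (hu : f u % 2 = 0) (hv : f v % 2 = 0) : multiplicity G u v ≤ 1 := by
  have h : {e : β | G.IsLink e u v}.Subsingleton :=
    fun e he e' he' => hf.edge_unique e e' u v he he' hne hu hv
  have := h.finite.to_subtype
  exact Set.ncard_le_one_iff_subsingleton.2 h

lemma multiplicity_pos {G : Graph α β} (hfin : E(G).Finite) {u v : α} (h : G.Adj u v) :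
    0 < multiplicity G u v := by
  obtain ⟨e, he⟩ := h
  exact (Set.ncard_pos (hfin.subset fun e' (he' : G.IsLink e' u v) => he'.edge_mem)).2 ⟨e, he⟩

/-- Even positions differ by at least `2`, so `r` vertices at even positions span `2 * (r - 1)`. -/
lemma IsLayout.exists_extremes {G : Graph α β} {f : α → ℤ} (hf : IsLayout G f)
    (hfin : V(G).Finite) (hpos : (evenSet G f).Nonempty) :
    ∃ u ∈ evenSet G f, ∃ w ∈ evenSet G f, 2 * ((evenSet G f).ncard : ℤ) ≤ f w - f u + 2 := by
  have hE : (evenSet G f).Finite := hfin.subset fun v hv => hv.1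
  obtain ⟨u, hu, hmin⟩ := Set.exists_min_image _ f hE hpos
  obtain ⟨w, hw, hmax⟩ := Set.exists_max_image _ f hE hpos
  refine ⟨u, hu, w, hw, ?_⟩
  have h1 : (evenSet G f).ncard ≤ (Set.Icc (f u / 2) (f w / 2)).ncard := by
    refine Set.ncard_le_ncard_of_injOn (fun v => f v / 2) ?_ ?_ (Set.finite_Icc _ _)
    · intro v hv
      have := hmin v hv
      have := hmax v hv
      exact ⟨by omega, by omega⟩
    · intro v hv v' hv' h
      have h2 := hv.2
      have h3 := hv'.2
      dsimp only at h
      exact hf.eq_of_even v hv.1 v' hv'.1 hv.2 (by omega)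
  have h2 : (Set.Icc (f u / 2) (f w / 2)).ncard = (f w / 2 + 1 - f u / 2).toNat := by
    rw [← Finset.coe_Icc, Set.ncard_coe_finset, Int.card_Icc]
  have h3 := hu.2
  have h4 := hw.2
  have h5 := hmin w hw
  omega

namespace IsTightLayout

variable {G : Graph α β} {m : ℕ} {L : ℤ} {f g : α → ℤ}

lemma abs_sub_le_of (hg : IsTightLayout G m L g) (hf : IsLayout G f) {u v : α} (hu : u ∈ V(G))
    (hv : v ∈ V(G)) (h : |g u - g v| ≤ 2) : |f u - f v| ≤ 2 := by
  by_cases huv : u = v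
  · simp [huv]
  · obtain ⟨e, he⟩ := hg.adj u hu v hv huv h
    exact hf.abs_sub_le e u v he

/-- The vertices at even positions of `g` form a path along which `f` grows by at most `2` in each
step. -/
lemma sub_le_of_even (hg : IsTightLayout G m L g) (hf : IsLayout G f) {v : α} (hv : v ∈ V(G))
    (n : ℕ) : ∀ q ∈ V(G), g q = 2 * (g v / 2) + 2 * n → g v ≤ g q →
    f q - f v ≤ g q - 2 * (g v / 2) := by
  induction n with
  | zero =>
    intro q hq h hle
    have : v = q := hg.eq_of_even v hv q hq (by omega) (by omega)
    subst this
    omega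
  | succ n ih =>
    intro q hq h hle
    by_cases hdir : g q - g v ≤ 2
    · have := hg.abs_sub_le_of hf hq hv (by rw [abs_le]; omega)
      rw [abs_le] at this
      omega
    · have h0 := hg.nonneg v hv
      have h1 := hg.le q hq
      obtain ⟨q', hq', hgq'⟩ := hg.exists_even (g v / 2 + n) (by omega) (by omega)
      have h2 := ih q' hq' (by omega) (by omega)
      have h3 := hg.abs_sub_le_of hf hq hq' (by rw [abs_le]; omega)
      rw [abs_le] at h3
      omega

/-- The bound is twice the number of edges of the walk from `u` to `w` through the even positions
between `g u` and `g w`. -/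
lemma sub_le (hg : IsTightLayout G m L g) (hf : IsLayout G f) {u w : α} (hu : u ∈ V(G))
    (hw : w ∈ V(G)) (huw : g u ≤ g w) : f w - f u ≤ 2 * ((g w + 1) / 2) - 2 * (g u / 2) := by
  by_cases hdir : g w % 2 = 1 ∧ g w = g u
  · have := hg.abs_sub_le_of hf hw hu (by rw [abs_le]; omega)
    rw [abs_le] at this
    omega
  · have h0 := hg.nonneg w hw
    have h1 := hg.le w hw
    obtain ⟨q, hq, hgq⟩ := hg.exists_even (g w / 2) (by omega) (by omega)
    have h2 := hg.sub_le_of_even hf hu (g w / 2 - g u / 2).toNat q hq (by omega) (by omega)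
    by_cases hqw : g w % 2 = 0
    · have : q = w := hg.eq_of_even q hq w hw (by omega) (by omega)
      subst this
      omega
    · have h3 := hg.abs_sub_le_of hf hw hq (by rw [abs_le]; omega)
      rw [abs_le] at h3
      omega

lemma sub_le_two_mul (hg : IsTightLayout G m L g) (hf : IsLayout G f) {u w : α} (hu : u ∈ V(G))
    (hw : w ∈ V(G)) : f w - f u ≤ 2 * L := by
  have h1 := hg.nonneg u hu
  have h2 := hg.le u hu
  have h3 := hg.nonneg w hw
  have h4 := hg.le w hw
  rcases le_total (g u) (g w) with h | h
  · have := hg.sub_le hf hu hw h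
    omega
  · have := hg.sub_le hf.neg hw hu h
    omega

lemma ncard_evenSet_le (hg : IsTightLayout G m L g) (hf : IsLayout G f) (hL : 0 ≤ L)
    (hfin : V(G).Finite) : ((evenSet G f).ncard : ℤ) ≤ L + 1 := by
  rcases (evenSet G f).eq_empty_or_nonempty with h | h
  · rw [h, Set.ncard_empty]
    omega
  · obtain ⟨u, hu, w, hw, hle⟩ := hf.exists_extremes hfin h
    have := hg.sub_le_two_mul hf hu.1 hw.1
    omega

section Extremal

/- A layout `f` is extremal if two vertices `u₀` and `w` at even positions attain the largest
possible distance `2 * L`. Then every bound used along a walk from `u₀` to `w` is an equality. -/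
variable {u₀ w : α}

lemma eq_of_extremes_of_even (hg : IsTightLayout G m L g) (hf : IsLayout G f)
    (hu₀ : u₀ ∈ evenSet G f) (hw : w ∈ evenSet G f) (huw : f w - f u₀ = 2 * L) (h : g u₀ ≤ g w)
    {q : α} (hq : q ∈ V(G)) (hq0 : g q % 2 = 0) (hq2 : 2 ≤ g q) (hqL : g q ≤ 2 * L - 2) :
    f q = f u₀ + g q := by
  have h1 := hg.sub_le hf hu₀.1 hw.1 h
  have h2 := hg.nonneg u₀ hu₀.1
  have h3 := hg.le w hw.1
  have h4 := hg.sub_le hf hu₀.1 hq (by omega)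
  have h5 := hg.sub_le hf hq hw.1 (by omega)
  omega

/-- Between its extremes, an extremal layout is a translate of the tight one: a vertex at an odd
position of `g` has two neighbours whose positions are known. -/
lemma eq_of_extremes (hg : IsTightLayout G m L g) (hf : IsLayout G f)
    (hu₀ : u₀ ∈ evenSet G f) (hw : w ∈ evenSet G f) (huw : f w - f u₀ = 2 * L) (h : g u₀ ≤ g w)
    {z : α} (hz : z ∈ V(G)) (hz2 : 2 ≤ g z) (hzL : g z ≤ 2 * L - 2) :
    f z = f u₀ + g z := by
  by_cases hz0 : g z % 2 = 0
  · exact hg.eq_of_extremes_of_even hf hu₀ hw huw h hz hz0 hz2 hzL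
  have h0 := hu₀.2
  obtain ⟨q, hq, hgq⟩ := hg.exists_even (g z / 2) (by omega) (by omega)
  obtain ⟨q', hq', hgq'⟩ := hg.exists_even (g z / 2 + 1) (by omega) (by omega)
  have h1 := hg.eq_of_extremes_of_even hf hu₀ hw huw h hq (by omega) (by omega) (by omega)
  have h2 := hg.eq_of_extremes_of_even hf hu₀ hw huw h hq' (by omega) (by omega) (by omega)
  have h3 := hg.abs_sub_le_of hf hz hq (by rw [abs_le]; omega)
  have h4 := hg.abs_sub_le_of hf hz hq' (by rw [abs_le]; omega)
  have h5 : f z ≠ f q := fun h5 => by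
    have := hf.eq_of_even z hz q hq (by omega) h5
    subst this
    omega
  have h6 : f z ≠ f q' := fun h6 => by
    have := hf.eq_of_even z hz q' hq' (by omega) h6
    subst this
    omega
  rw [abs_le] at h3 h4
  omega

/-- A vertex at position `0` or `1` of `g` is adjacent to `u₀` and to the vertex at position `2`,
which fixes its position under `f`. -/
lemma eq_of_extremes_of_low (hg : IsTightLayout G m L g) (hf : IsLayout G f) (hL : 2 ≤ L)
    (hu₀ : u₀ ∈ evenSet G f) (hw : w ∈ evenSet G f) (huw : f w - f u₀ = 2 * L) (h : g u₀ ≤ g w)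
    {z : α} (hz : z ∈ V(G)) (hz1 : g z ≤ 1) : z = u₀ ∨ f z = f u₀ + 1 := by
  have h1 := hg.sub_le hf hu₀.1 hw.1 h
  have h2 := hg.nonneg u₀ hu₀.1
  have h3 := hg.le w hw.1
  have h4 := hg.nonneg z hz
  have h0 := hu₀.2
  obtain ⟨q, hq, hgq⟩ := hg.exists_even 1 (by omega) (by omega)
  have h5 := hg.eq_of_extremes_of_even hf hu₀ hw huw h hq (by omega) (by omega) (by omega)
  have h6 := hg.abs_sub_le_of hf hz hu₀.1 (by rw [abs_le]; omega)
  have h7 := hg.abs_sub_le_of hf hz hq (by rw [abs_le]; omega)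
  rw [abs_le] at h6 h7
  by_contra! hne
  have h8 : f z ≠ f u₀ := fun h8 => hne.1 (hf.eq_of_even z hz u₀ hu₀.1 (by omega) h8)
  have h9 : f z ≠ f q := fun h9 => by
    have := hf.eq_of_even z hz q hq (by omega) h9
    subst this
    omega
  omega

/-- The mirror image of `eq_of_extremes_of_low` at the upper end. -/
lemma eq_of_extremes_of_high (hg : IsTightLayout G m L g) (hf : IsLayout G f) (hL : 2 ≤ L)
    (hu₀ : u₀ ∈ evenSet G f) (hw : w ∈ evenSet G f) (huw : f w - f u₀ = 2 * L) (h : g u₀ ≤ g w)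
    {z : α} (hz : z ∈ V(G)) (hz1 : 2 * L - 1 ≤ g z) : z = w ∨ f z = f w - 1 := by
  have h1 := hg.sub_le hf hu₀.1 hw.1 h
  have h2 := hg.nonneg u₀ hu₀.1
  have h3 := hg.le w hw.1
  have h4 := hg.le z hz
  have h0 := hw.2
  obtain ⟨q, hq, hgq⟩ := hg.exists_even (L - 1) (by omega) (by omega)
  have h5 := hg.eq_of_extremes_of_even hf hu₀ hw huw h hq (by omega) (by omega) (by omega)
  have h6 := hg.abs_sub_le_of hf hz hw.1 (by rw [abs_le]; omega)
  have h7 := hg.abs_sub_le_of hf hz hq (by rw [abs_le]; omega)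
  rw [abs_le] at h6 h7
  by_contra! hne
  have h8 : f z ≠ f w := fun h8 => hne.1 (hf.eq_of_even z hz w hw.1 (by omega) h8)
  have h9 : f z ≠ f q := fun h9 => by
    have := hf.eq_of_even z hz q hq (by omega) h9
    subst this
    omega
  omega

/-- An extremal layout has no more pairs at distance at most `2` than the tight one. It need not be
a translate of the tight one: if `u₀` is at position `1` of `g`, then it takes the role of the
vertex at position `0`, which is possible only if no vertex is at position `3` of `g`; likewise for
`w`. -/
lemma abs_sub_le_of_extremes (hg : IsTightLayout G m L g) (hf : IsLayout G f)
    (hu₀ : u₀ ∈ evenSet G f) (hw : w ∈ evenSet G f) (huw : f w - f u₀ = 2 * L) (h : g u₀ ≤ g w)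
    {u v : α} (hu : u ∈ V(G)) (hv : v ∈ V(G)) (huv : |f u - f v| ≤ 2) : |g u - g v| ≤ 2 := by
  wlog hlt : g u ≤ g v generalizing u v
  · rw [abs_sub_comm]
    exact this hv hu (by rwa [abs_sub_comm]) (by omega)
  rw [abs_le] at huv ⊢
  by_contra hcon
  have hu0 := hg.nonneg u hu
  have hvL := hg.le v hv
  have h1 := hg.sub_le hf hu₀.1 hw.1 h
  have h2 := hg.nonneg u₀ hu₀.1
  have h3 := hg.le w hw.1
  have hmu : 2 ≤ g u → f u = f u₀ + g u := fun h4 =>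
    hg.eq_of_extremes hf hu₀ hw huw h hu h4 (by omega)
  have hmv : g v ≤ 2 * L - 2 → f v = f u₀ + g v := fun h4 =>
    hg.eq_of_extremes hf hu₀ hw huw h hv (by omega) h4
  have hlu : g u ≤ 1 → f u = f u₀ ∨ f u = f u₀ + 1 := fun h4 =>
    (hg.eq_of_extremes_of_low hf (by omega) hu₀ hw huw h hu h4).imp_left (by rintro rfl; rfl)
  have hhv : 2 * L - 1 ≤ g v → f v = f w ∨ f v = f w - 1 := fun h4 =>
    (hg.eq_of_extremes_of_high hf (by omega) hu₀ hw huw h hv h4).imp_left (by rintro rfl; rfl)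
  have hu₀u : g u₀ = g u → g u % 2 = 0 → f u = f u₀ := fun h4 h5 => by
    rw [hg.eq_of_even u hu u₀ hu₀.1 h5 h4.symm]
  have hwv : g w = g v → g v % 2 = 0 → f v = f w := fun h4 h5 => by
    rw [hg.eq_of_even v hv w hw.1 h5 h4.symm]
  -- a vertex too close to `u₀` or `w` under `g` contradicts its known position under `f`
  have a1 : g v - g u₀ ≤ 2 → f v - f u₀ ≤ 2 := fun h4 => by
    have := hg.abs_sub_le_of hf hv hu₀.1 (by rw [abs_le]; omega)
    rw [abs_le] at this
    omega
  have a2 : g w - g u ≤ 2 → f w - f u ≤ 2 := fun h4 => by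
    have := hg.abs_sub_le_of hf hw.1 hu (by rw [abs_le]; omega)
    rw [abs_le] at this
    omega
  have a3 : g w - g u₀ ≤ 2 → f w - f u₀ ≤ 2 := fun h4 => by
    have := hg.abs_sub_le_of hf hw.1 hu₀.1 (by rw [abs_le]; omega)
    rw [abs_le] at this
    omega
  rcases le_or_gt (g u) 1 with c1 | c1 <;> rcases le_or_gt (g v) (2 * L - 2) with c2 | c2
  · have := hlu c1
    have := hmv c2
    omega
  · have := hlu c1
    have := hhv (by omega)
    omega
  · have := hmu c1
    have := hmv c2
    omega
  · have := hmu c1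
    have := hhv (by omega)
    omega

/-- If `m ≥ 2`, then the extremes of an extremal layout are those of the tight one, since otherwise
they would have an edge of multiplicity `m` to a vertex at an even position. -/
lemma extremes_eq (hg : IsTightLayout G m L g) (hf : IsLayout G f) (hL : 1 ≤ L) (hm : 2 ≤ m)
    (hu₀ : u₀ ∈ evenSet G f) (hw : w ∈ evenSet G f) (huw : f w - f u₀ = 2 * L) (h : g u₀ ≤ g w) :
    g u₀ = 0 ∧ g w = 2 * L := by
  have h1 := hg.sub_le hf hu₀.1 hw.1 h
  have h2 := hg.nonneg u₀ hu₀.1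
  have h3 := hg.le w hw.1
  have hu0 := hu₀.2
  have hw0 := hw.2
  have key : ∀ s ∈ evenSet G f, ∀ t ∈ evenSet G f, f s ≠ f t → |g s - g t| ≤ 2 → g s % 2 = 0 := by
    intro s hs t ht hne hle
    have hst : s ≠ t := by rintro rfl; exact hne rfl
    by_contra hodd
    have h4 := hg.multiplicity_eq s t (hg.adj s hs.1 t ht.1 hst hle) fun h5 => hodd h5.1
    have h5 := hf.multiplicity_le_one hst hs.2 ht.2
    omega
  by_cases hL2 : 2 ≤ L
  · obtain ⟨q, hq, hgq⟩ := hg.exists_even 1 (by omega) (by omega)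
    obtain ⟨q', hq', hgq'⟩ := hg.exists_even (L - 1) (by omega) (by omega)
    have h5 := hg.eq_of_extremes_of_even hf hu₀ hw huw h hq (by omega) (by omega) (by omega)
    have h6 := hg.eq_of_extremes_of_even hf hu₀ hw huw h hq' (by omega) (by omega) (by omega)
    have h7 := key u₀ hu₀ q ⟨hq, by omega⟩ (by omega) (by rw [abs_le]; omega)
    have h8 := key w hw q' ⟨hq', by omega⟩ (by omega) (by rw [abs_le]; omega)
    omega
  · have h7 := key u₀ hu₀ w hw (by omega) (by rw [abs_le]; omega)
    have h8 := key w hw u₀ hu₀ (by omega) (by rw [abs_le]; omega)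
    omega

lemma multiplicity_eq_or_of_extremes (hg : IsTightLayout G m L g) (hf : IsLayout G f)
    (hE : E(G).Finite) (hL : 1 ≤ L) (hm : 1 ≤ m)
    (hu₀ : u₀ ∈ evenSet G f) (hw : w ∈ evenSet G f) (huw : f w - f u₀ = 2 * L) (h : g u₀ ≤ g w)
    {u v : α} (hu : u ∈ V(G)) (hv : v ∈ V(G)) (hne : u ≠ v) (huv : |f u - f v| ≤ 2) :
    multiplicity G u v = m ∨ G.Adj u v ∧ f u % 2 = 0 ∧ f v % 2 = 0 := by
  have hadj := hg.adj u hu v hv hne (hg.abs_sub_le_of_extremes hf hu₀ hw huw h hu hv huv)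
  by_cases hev : g u % 2 = 0 ∧ g v % 2 = 0
  swap
  · exact Or.inl (hg.multiplicity_eq u v hadj hev)
  -- for `m = 1` the single edge between even positions already has full multiplicity
  by_cases hm1 : m = 1
  · have h1 := hg.toIsLayout.multiplicity_le_one hne hev.1 hev.2
    have h2 := multiplicity_pos hE hadj
    exact Or.inl (by omega)
  · obtain ⟨h1, h2⟩ := hg.extremes_eq hf hL (by omega) hu₀ hw huw h
    have key : ∀ z ∈ V(G), g z % 2 = 0 → f z % 2 = 0 := by
      intro z hz hz0
      have h3 := hg.nonneg z hz
      have h4 := hg.le z hz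
      have h5 := hu₀.2
      by_cases hz1 : g z = 0
      · rw [hg.eq_of_even z hz u₀ hu₀.1 hz0 (by omega)]
        exact hu₀.2
      by_cases hz2 : g z = 2 * L
      · rw [hg.eq_of_even z hz w hw.1 hz0 (by omega)]
        exact hw.2
      have := hg.eq_of_extremes_of_even hf hu₀ hw huw h hz hz0 (by omega) (by omega)
      omega
    exact Or.inr ⟨hadj, key u hu hev.1, key v hv hev.2⟩

end Extremal

/-- A layout with as many vertices at even positions as a tight one allows no edges beyond those
of `G`, up to multiplicity `m` and the single edges between even positions. -/
lemma multiplicity_eq_or (hg : IsTightLayout G m L g) (hf : IsLayout G f) (hG : IsMultigraph G)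
    (hL : 1 ≤ L) (hm : 1 ≤ m) (hcard : L + 1 ≤ (evenSet G f).ncard)
    {u v : α} (hu : u ∈ V(G)) (hv : v ∈ V(G)) (hne : u ≠ v) (huv : |f u - f v| ≤ 2) :
    multiplicity G u v = m ∨ G.Adj u v ∧ f u % 2 = 0 ∧ f v % 2 = 0 := by
  obtain ⟨u₀, hu₀, w, hw, hle⟩ := hf.exists_extremes hG.finite_vertexSet
    (Set.nonempty_of_ncard_ne_zero (by omega))
  have h1 := hg.sub_le_two_mul hf hu₀.1 hw.1
  rcases le_total (g u₀) (g w) with h | h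
  · exact hg.multiplicity_eq_or_of_extremes hf hG.finite_edgeSet hL hm hu₀ hw (by omega) h hu hv
      hne huv
  · have hneg : ∀ v ∈ evenSet G f, v ∈ evenSet G fun v => - f v := fun v hv => ⟨hv.1, by
      have := hv.2
      dsimp only
      omega⟩
    have := hg.multiplicity_eq_or_of_extremes (u₀ := w) (w := u₀) hf.neg hG.finite_edgeSet hL hm
      (hneg w hw) (hneg u₀ hu₀) (by omega) h hu hv hne (by rw [abs_le] at huv ⊢; omega)
    exact this.imp_right fun h => ⟨h.1, by omega, by omega⟩

end IsTightLayout

/-! ### Crowded parades -/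

section Crowded

variable {G : Graph α β} {a b : α} {P : Walk G a b} {m p : ℕ}

/-- A vertex outside `P` is placed halfway between its two neighbours on `P`, whose positions are
`2 * distTo G b y` and `2 * distTo G b z`. -/
lemma IsCrowdedAlong.exists_position_eq (hP : IsCrowdedAlong G P) {x : α} (hx : x ∈ V(G))
    (hxP : x ∉ P.support) : ∃ y ∈ P.support, ∃ z ∈ P.support, G.Adj x y ∧ G.Adj x z ∧
      distTo G b z = distTo G b y + 1 ∧ position G P x = 2 * (distTo G b y : ℤ) + 1 := by
  obtain ⟨y, hy, z, hz, hne, hyz, hadj⟩ := hP.adj_two x hx hxP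
  wlog hle : distTo G b y ≤ distTo G b z generalizing y z
  · exact this z hz y hy hne.symm hyz.symm (fun t ht => by rw [hadj t ht, or_comm]) (by omega)
  have hU := hP.isParade.1.isUniqueShortestWalk
  have hxy : G.Adj x y := (hadj y hy).2 (Or.inl rfl)
  have hxz : G.Adj x z := (hadj z hz).2 (Or.inr rfl)
  have h1 : distTo G b y ≠ distTo G b z := fun h => hne (hU.distTo_injOn hy hz h)
  obtain ⟨e, he⟩ := hyz
  have h2 := distTo_le_succ (b := b) he.symm
  obtain ⟨e₁, he₁⟩ := id hxy
  obtain ⟨e₂, he₂⟩ := id hxz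
  have h3 := hU.isLayout.abs_sub_le _ _ _ he₁
  have h4 := hU.isLayout.abs_sub_le _ _ _ he₂
  have h5 : ¬ position G P x % 2 = 0 := mt position_even_iff.1 hxP
  rw [position_of_mem hy, abs_le] at h3
  rw [position_of_mem hz, abs_le] at h4
  exact ⟨y, hy, z, hz, hxy, hxz, by omega, by omega⟩

lemma IsCrowdedAlong.isTightLayout (hP : IsCrowdedAlong G P)
    (hm : ∀ (e : β) (x y : α), G.IsLink e x y → e ∉ P.edges → multiplicity G x y = m) :
    IsTightLayout G m P.length (position G P) := by
  have hU := hP.isParade.1.isUniqueShortestWalk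
  have hrange : ∀ v ∈ V(G), 0 ≤ position G P v ∧ position G P v ≤ 2 * (P.length : ℤ) := by
    intro v hv
    by_cases hvP : v ∈ P.support
    · have := hU.distTo_le_length hvP
      rw [position_of_mem hvP]
      omega
    · obtain ⟨y, -, z, hz, -, -, hyz, hpos⟩ := hP.exists_position_eq hv hvP
      have := hU.distTo_le_length hz
      omega
  have hmix : ∀ u ∈ V(G), ∀ v ∈ V(G), u ∉ P.support → v ∈ P.support →
      |position G P u - position G P v| ≤ 2 → G.Adj u v := by
    intro u hu v hv huP hvP hle
    obtain ⟨y, hy, z, hz, hay, haz, hyz, hpos⟩ := hP.exists_position_eq hu huP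
    rw [hpos, position_of_mem hvP, abs_le] at hle
    by_cases h : distTo G b v = distTo G b y
    · rwa [hU.distTo_injOn hvP hy h]
    · rwa [hU.distTo_injOn hvP hz (by omega)]
  refine ⟨hU.isLayout, fun v hv => (hrange v hv).1, fun v hv => (hrange v hv).2, ?_, ?_, ?_⟩
  · intro i hi0 hiL
    obtain ⟨q, hq, hqi⟩ := hU.exists_distTo_eq (i := i.toNat) (by omega)
    exact ⟨q, P.mem_vertexSet_of_mem_support hq, by rw [position_of_mem hq, hqi]; omega⟩
  · intro u hu v hv hne hle
    by_cases huP : u ∈ P.support <;> by_cases hvP : v ∈ P.support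
    · rw [position_of_mem huP, position_of_mem hvP, abs_le] at hle
      have h1 : distTo G b u ≠ distTo G b v := fun h => hne (hU.distTo_injOn huP hvP h)
      rcases lt_or_gt_of_ne h1 with h2 | h2
      · exact (hU.adj_of_distTo_succ hvP huP (by omega)).symm
      · exact hU.adj_of_distTo_succ huP hvP (by omega)
    · exact (hmix v hv u hu hvP huP (by rwa [abs_sub_comm])).symm
    · exact hmix u hu v hv huP hvP hle
    · obtain ⟨y, hy, z, hz, hay, haz, hyz, hpos⟩ := hP.exists_position_eq hu huP
      obtain ⟨y', hy', z', hz', hay', haz', hyz', hpos'⟩ := hP.exists_position_eq hv hvP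
      rw [hpos, hpos', abs_le] at hle
      refine hP.adj_of_common u hu v hv huP hvP hne ?_
      rcases (by omega : distTo G b y = distTo G b y' ∨ distTo G b y = distTo G b z' ∨
        distTo G b z = distTo G b y') with h | h | h
      · exact ⟨y, hy, hay, by rwa [hU.distTo_injOn hy hy' h]⟩
      · exact ⟨y, hy, hay, by rwa [hU.distTo_injOn hy hz' h]⟩
      · exact ⟨z, hz, haz, by rwa [hU.distTo_injOn hz hy' h]⟩
  · rintro u v ⟨e, he⟩ hodd
    refine hm e u v he fun heP => hodd ?_
    exact ⟨position_even_iff.2 (P.mem_support_of_mem_edges heP he),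
      position_even_iff.2 (P.mem_support_of_mem_edges heP he.symm)⟩

lemma IsSaturatedCrowdedParade.exists_isUniqueShortestPath (h : IsSaturatedCrowdedParade m p G)
    (hne : V(G).Nonempty) : ∃ (a b : α) (P : Walk G a b), P.IsUniqueShortestPath ∧ P.order = p := by
  obtain ⟨-, a, b, P, hP, hord, -⟩ | ⟨rfl, -⟩ := h
  · exact ⟨a, b, P, hP.isParade.1, hord⟩
  · obtain ⟨x, hx⟩ := hne
    exact ⟨x, x, _, isUniqueShortestPath_nil hx, rfl⟩

lemma multiplicity_self (hG : IsMultigraph G) (x : α) : multiplicity G x x = 0 := by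
  have := hG.loopless
  have h : {e : β | G.IsLink e x x} = ∅ :=
    Set.eq_empty_iff_forall_notMem.2 fun e he => Graph.IsLink.ne he rfl
  rw [multiplicity, h, Set.ncard_empty]

lemma IsSaturatedCrowdedParade.multiplicity_le (h : IsSaturatedCrowdedParade m p G)
    (hG : IsMultigraph G) (hm : 1 ≤ m) {x y : α} (hx : x ∈ V(G)) (hy : y ∈ V(G)) :
    multiplicity G x y ≤ m := by
  by_cases hxy : x = y
  · subst hxy
    rw [multiplicity_self hG]
    exact Nat.zero_le _
  obtain ⟨-, a, b, P, hP, -, hmul⟩ | ⟨-, hmul⟩ := h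
  · have hg := hP.isTightLayout hmul
    by_cases hev : position G P x % 2 = 0 ∧ position G P y % 2 = 0
    · exact (hg.toIsLayout.multiplicity_le_one hxy hev.1 hev.2).trans hm
    · rcases Nat.eq_zero_or_pos (multiplicity G x y) with h0 | h0
      · omega
      · obtain ⟨e, he⟩ := Set.nonempty_of_ncard_ne_zero h0.ne'
        exact (hg.multiplicity_eq x y ⟨e, he⟩ hev).le
  · exact (hmul x hx y hy hxy).le

lemma IsSaturatedCrowdedParade.ncard_evenSet_le (h : IsSaturatedCrowdedParade m p G)
    (hG : IsMultigraph G) (hpm : p = 1 → 2 ≤ m) {f : α → ℤ} (hf : IsLayout G f) :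
    (evenSet G f).ncard ≤ p := by
  obtain ⟨-, a, b, P, hP, hord, hmul⟩ | ⟨rfl, hmul⟩ := h
  · have h1 := (hP.isTightLayout hmul).ncard_evenSet_le hf (by omega) hG.finite_vertexSet
    simp only [Walk.order] at hord
    omega
  · have hs : (evenSet G f).Subsingleton := by
      intro u hu v hv
      by_contra hne
      have h1 := hmul u hu.1 v hv.1 hne
      have h2 := hf.multiplicity_le_one hne hu.2 hv.2
      have := hpm rfl
      omega
    have := hs.finite.to_subtype
    exact Set.ncard_le_one_iff_subsingleton.2 hs

lemma IsSaturatedCrowdedParade.multiplicity_eq_or (h : IsSaturatedCrowdedParade m p G)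
    (hG : IsMultigraph G) (hm : 1 ≤ m) {f : α → ℤ} (hf : IsLayout G f)
    (hcard : p ≤ (evenSet G f).ncard) {u v : α} (hu : u ∈ V(G)) (hv : v ∈ V(G)) (hne : u ≠ v)
    (huv : |f u - f v| ≤ 2) :
    multiplicity G u v = m ∨ G.Adj u v ∧ f u % 2 = 0 ∧ f v % 2 = 0 := by
  obtain ⟨hp, a, b, P, hP, hord, hmul⟩ | ⟨-, hmul⟩ := h
  · simp only [Walk.order] at hord
    exact (hP.isTightLayout hmul).multiplicity_eq_or hf hG (by omega) hm (by omega) hu hv hne huv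
  · exact Or.inl (hmul u hu v hv hne)

lemma IsSaturatedCrowdedParade.spectatorFloor_eq {n k : ℕ}
    (h : IsSaturatedCrowdedParade m (n - k) G) (hG : IsMultigraph G) (hn : V(G).ncard = n)
    (hk : k ≤ n) (hpm : n - k = 1 → 2 ≤ m) : spectatorFloor G = k := by
  apply le_antisymm
  · obtain ⟨a, b, P, hP, hord⟩ := h.exists_isUniqueShortestPath hG.nonempty
    have h1 := order_le_paradeNumber hG.finite_vertexSet hP
    have h2 := spectatorFloor_le_spectatorNumber hG
    rw [spectatorNumber] at h2
    omega
  · obtain ⟨f, hf, hle⟩ := exists_isLayout_ncard_oddSet_le hG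
    have h1 := ncard_oddSet_add_ncard_evenSet G f hG.finite_vertexSet
    have h2 := h.ncard_evenSet_le hG hpm hf
    omega

end Crowded

lemma Iso.isLink_of_isLink {G : Graph α β} {K : Graph α' β'} (ψ : Iso G K) {e : β} {u v : V(G)}
    (h : G.IsLink e u v) : ∃ e', K.IsLink e' (ψ.vertexEquiv u) (ψ.vertexEquiv v) :=
  ⟨_, (ψ.isLink_iff ⟨e, h.edge_mem⟩ u v).1 h⟩

lemma Iso.multiplicity_eq {G : Graph α β} {K : Graph α' β'} (ψ : Iso G K) (u v : V(G)) :
    multiplicity G u v = multiplicity K (ψ.vertexEquiv u) (ψ.vertexEquiv v) := by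
  refine Set.ncard_congr (fun e (he : G.IsLink e u v) => (ψ.edgeEquiv ⟨e, he.edge_mem⟩ : β'))
    ?_ ?_ ?_
  · intro e he
    exact (ψ.isLink_iff ⟨e, Graph.IsLink.edge_mem he⟩ u v).1 he
  · intro e e' he he' h
    simpa using ψ.edgeEquiv.injective (Subtype.ext h)
  · intro e' (he' : K.IsLink e' _ _)
    have h : G.IsLink (ψ.edgeEquiv.symm ⟨e', he'.edge_mem⟩) u v := by
      rw [ψ.isLink_iff]
      simpa using he'
    exact ⟨_, h, by simp⟩

/-- If a spanning subgraph `K` of `H` is a saturated crowded parade up to isomorphism, and `H` has a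
layout with few vertices at odd positions, then `K` has all edges of `H`. -/
lemma IsSaturatedCrowdedParade.eq_of_iso_of_le {G : Graph α β} {H K : Graph α' β'} {m p : ℕ}
    (h : IsSaturatedCrowdedParade m p G) (hG : IsMultigraph G) (hH : IsMultigraph H) (hm : 1 ≤ m)
    (ψ : Iso G K) (hle : K ≤ H) (hV : V(K) = V(H))
    (hmul : ∀ x ∈ V(H), ∀ y ∈ V(H), multiplicity H x y ≤ m) {f : α' → ℤ} (hf : IsLayout H f)
    (hcard : (oddSet H f).ncard + p ≤ V(G).ncard) : K = H := by
  obtain ⟨g, hg, hgf, hodd⟩ := (hf.mono hle).exists_of_iso ψ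
  have h1 := ncard_oddSet_add_ncard_evenSet G g hG.finite_vertexSet
  have h2 : oddSet K f = oddSet H f := by simp only [oddSet, hV]
  rw [h2] at hodd
  refine Graph.ext hV fun e x y => ⟨fun he => hle.isLink_mono he, fun he => ?_⟩
  have hne : x ≠ y := by
    have := hH.loopless
    exact he.ne
  set u := ψ.vertexEquiv.symm ⟨x, hV ▸ he.left_mem⟩ with hu
  set v := ψ.vertexEquiv.symm ⟨y, hV ▸ he.right_mem⟩ with hv
  have hux : (ψ.vertexEquiv u : α') = x := by simp [hu]
  have hvy : (ψ.vertexEquiv v : α') = y := by simp [hv]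
  have hgu : g u = f x := by rw [hgf, hux]
  have hgv : g v = f y := by rw [hgf, hvy]
  have huv : (u : α) ≠ v := fun huv => hne (by rw [← hux, ← hvy, Subtype.ext huv])
  rcases h.multiplicity_eq_or hG hm hg (by omega) u.2 v.2 huv
    (by rw [hgu, hgv]; exact hf.abs_sub_le e x y he) with h3 | ⟨⟨e', he'⟩, h4, h5⟩
  · rw [ψ.multiplicity_eq, hux, hvy] at h3
    have hsub : {e | K.IsLink e x y} ⊆ {e | H.IsLink e x y} := fun e he => hle.isLink_mono he
    have hfin : {e | H.IsLink e x y}.Finite :=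
      hH.finite_edgeSet.subset fun e he => Graph.IsLink.edge_mem he
    have heq := Set.eq_of_subset_of_ncard_le hsub
      ((hmul x he.left_mem y he.right_mem).trans h3.ge) hfin
    exact heq.ge he
  · obtain ⟨e'', he''⟩ := ψ.isLink_of_isLink he'
    rw [hux, hvy] at he''
    rwa [hf.edge_unique e e'' x y he (hle.isLink_mono he'') hne (hgu ▸ h4) (hgv ▸ h5)]

end SpectatorFloor

theorem mainTheorem6 {α : Type u} {β : Type v} (G : Graph α β) (n m k : ℕ)
    (hkm : (k + 2 ≤ n ∧ 1 ≤ m) ∨ (k + 1 = n ∧ 2 ≤ m))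
    (hG : SpectatorFloor.IsMultigraph G) (hn : G.vertexSet.ncard = n)
    (hsat : SpectatorFloor.IsSaturatedCrowdedParade m (n - k) G) :
    SpectatorFloor.IsMinorMaximal
      (fun (α' : Type u) (β' : Type v) (H : Graph α' β') =>
        SpectatorFloor.InFloorClass n m k H) G := by
  have hm : 1 ≤ m := by omega
  refine ⟨⟨hG, hn, fun x hx y hy => hsat.multiplicity_le hG hm hx hy,
    hsat.spectatorFloor_eq hG hn (by omega) (by omega)⟩, ?_⟩
  rintro α' β' H ⟨hH, hHn, hmul, hfloor⟩ ⟨K, hHK, ⟨ψ⟩⟩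
  obtain ⟨-, ⟨hle, hV⟩ | hlt⟩ := SpectatorFloor.le_or_ncard_lt_of_reflTransGen hHK
    hH.finite_vertexSet
  · obtain ⟨f, hf, hodd⟩ := SpectatorFloor.exists_isLayout_ncard_oddSet_le hH
    rw [← hsat.eq_of_iso_of_le hG hH hm ψ hle hV hmul hf (by omega)]
    exact ⟨ψ⟩
  · have : G.vertexSet.ncard = K.vertexSet.ncard := Nat.card_congr ψ.vertexEquiv
    omega
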